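/- For a complex matrix $M$ let $M^*$ be its conjugate transpose and $r(M)$ its rank; for Hermitian $M$ let $i_+(M)$ and $i_-(M)$ be the numbers of positive and negative eigenvalues of $M$, counted with multiplicity. For Hermitian $M,N$ write $M\succcurlyeq N$ ($M\succ N$) if $M-N$ is positive semidefinite (positive definite). Let $A\in\mathbb C^{m\times n}$, let $B,C\in\mathbb C^{m\times m}$ be Hermitian, and suppose that $$\mathcal S_1=\{X\in\mathbb C^{n\times n}: X=X^*,\ AXA^*\succcurlyeq B\}$$ is nonempty. Put $$K_1=\begin{bmatrix} B&B&A\\ B&B-C&0\\ A^*&0&0\end{bmatrix},\qquad K_2=\begin{bmatrix} C&A\\ A^*&0\end{bmatrix},\qquad K_3=\begin{bmatrix} B&A\\ A^*&0\end{bmatrix}.$$ Then the following maxima and minima are attained, and \begin{align*} \max_{X\in\mathcal S_1} r(AXA^*-C)&=r[A,\,C],\\ \min_{X\in\mathcal S_1} r(AXA^*-C)&=i_+(K_1)-i_+(K_3)-i_-(K_2)+r[A,\,C],\\ \max_{X\in\mathcal S_1} i_+(AXA^*-C)&=i_-(K_2),\\ \max_{X\in\mathcal S_1} i_-(AXA^*-C)&=i_-(K_1)-i_-(K_3),\\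 \min_{X\in\mathcal S_1} i_+(AXA^*-C)&=i_+(K_1)-i_+(K_3),\\ \min_{X\in\mathcal S_1} i_-(AXA^*-C)&=r[A,\,C]-i_-(K_2). \end{align*} Consequently: (a) there is a Hermitian $X\in\mathbb C^{n\times n}$ with $AXA^*\succcurlyeq B$ and $AXA^*\succ C$ if and only if $i_-(K_2)=m$; (b) there is a Hermitian $X\in\mathbb C^{n\times n}$ with $C\succ AXA^*\succcurlyeq B$ if and only if $C\succ B$ and $i_-(K_1)=i_-(K_3)+m$; (c) there is a Hermitian $X\in\mathbb C^{n\times n}$ with $C\succcurlyeq AXA^*\succcurlyeq B$ if and only if $C\succcurlyeq B$ and $i_+(K_1)=i_+(K_3)$; (d) there is a Hermitian $X\in\mathbb C^{n\times n}$ with $AXA^*\succcurlyeq B$ and $AXA^*\succcurlyeq C$ if and only if $i_-(K_2)=r[A,\,C]$. -/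

import Mathlib

open scoped ComplexOrder

namespace LownerIneq

noncomputable section

/-- `i₊(M)`: the number of positive eigenvalues of `M`, counted with multiplicity
(multiplicity as a root of the characteristic polynomial). -/
def posInertia {ι : Type*} [Fintype ι] [DecidableEq ι] (M : Matrix ι ι ℂ) : ℕ := by
  classical exact M.charpoly.roots.countP (fun z => 0 < z)

/-- `i₋(M)`: the number of negative eigenvalues of `M`, counted with multiplicity. -/
def negInertia {ι : Type*} [Fintype ι] [DecidableEq ι] (M : Matrix ι ι ℂ) : ℕ := by
  classical exact M.charpoly.roots.countP (fun z => z < 0)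

/-- The Hermitian solution set of `A X A* ≽ B`. -/
def solutionSet {m n : ℕ} (A : Matrix (Fin m) (Fin n) ℂ) (B : Matrix (Fin m) (Fin m) ℂ) :
    Set (Matrix (Fin n) (Fin n) ℂ) :=
  {X | X.IsHermitian ∧ (A * X * A.conjTranspose - B).PosSemidef}

/-- The bordered matrix `[[M, A], [A*, 0]]`. -/
def bordered {m n : ℕ} (A : Matrix (Fin m) (Fin n) ℂ) (M : Matrix (Fin m) (Fin m) ℂ) :
    Matrix (Fin m ⊕ Fin n) (Fin m ⊕ Fin n) ℂ :=
  Matrix.fromBlocks M A A.conjTranspose 0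

/-- The matrix `K₁ = [[B, B, A], [B, B - C, 0], [A*, 0, 0]]`. -/
def matK1 {m n : ℕ} (A : Matrix (Fin m) (Fin n) ℂ) (B C : Matrix (Fin m) (Fin m) ℂ) :
    Matrix (Fin m ⊕ (Fin m ⊕ Fin n)) (Fin m ⊕ (Fin m ⊕ Fin n)) ℂ :=
  Matrix.fromBlocks B (Matrix.fromCols B A) (Matrix.fromRows B A.conjTranspose)
    (Matrix.fromBlocks (B - C) 0 0 0)

end

end LownerIneq

namespace LownerIneq

open Matrix

/-! ### Variational description of inertia. -/

section Inertia

variable {ι κ : Type*} [Fintype ι] [Fintype κ]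

/-! Everything rests on one principle: `posInertia H` is the largest number of columns of a `V` with
`Vᴴ * H * V` positive definite. Hence inertia is monotone in the Löwner order and invariant under
congruence. Write F(X) = AXA* - C.

Minimal solution. Some X₀ in the solution set satisfies AX₀A* ≼ AXA* for every other X in it
(`exists_minimal_solution`, `minimal_solution_le`). Monotonicity makes X₀ attain the minimum of
i₊(F) and the maximum of i₋(F). A congruence splits K₁ into F(X₀) and a block with the inertia of K₃
(`inertia_matK1`), which evaluates both.

Upward moves. X₀ + Q is feasible for every Q ≽ 0. Bordering F(X) by A absorbs AXA*, so i₊(F(X)) ≤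
i₋(K₂), and a large multiple of the identity as Q reaches this bound
(`exists_posInertia_bordered_le`). Always r[A, C] ≤ i₋(F(X)) + i₋(K₂) (`rank_fromCols_le_inertia`).
Rank-one updates attain equality without raising i₊ (`exists_minimal_inertia`), so both inertias,
and therefore the rank, are minimal at a single X.

The definiteness statements (a)-(d) read off when an extremal inertia is 0 or m. -/

theorem card_le_of_mulVec_injective {V : Matrix ι κ ℂ} (h : ∀ y, V *ᵥ y = 0 → y = 0) :
    Fintype.card κ ≤ Fintype.card ι := by
  have := LinearMap.finrank_le_finrank_of_injective (f := V.mulVecLin)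
    ((injective_iff_map_eq_zero _).2 h)
  simpa using this

theorem card_le_rank_of_mulVec_injective {ν μ : Type*} [Fintype μ] (T : Matrix ν μ ℂ)
    {V : Matrix μ κ ℂ} (h : ∀ y, (T * V) *ᵥ y = 0 → y = 0) :
    Fintype.card κ ≤ T.rank := by
  refine le_trans ?_ (rank_mul_le_left T V)
  rw [Matrix.rank, LinearMap.finrank_range_of_inj ((injective_iff_map_eq_zero _).2 h)]
  simp

variable [DecidableEq ι] [DecidableEq κ]

theorem charpoly_roots_conj_diagonal {U : Matrix ι ι ℂ} (hU : Uᴴ * U = 1) (d : ι → ℝ) :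
    (U * diagonal (fun i => (d i : ℂ)) * Uᴴ).charpoly.roots
      = Finset.univ.val.map (fun i => (d i : ℂ)) := by
  rw [charpoly_mul_comm, ← Matrix.mul_assoc, hU, Matrix.one_mul, charpoly_diagonal]
  rw [Polynomial.roots_prod]
  · simp
  · simp [Finset.prod_ne_zero_iff, Polynomial.X_sub_C_ne_zero]

theorem posInertia_conj_diagonal {U : Matrix ι ι ℂ} (hU : Uᴴ * U = 1) (d : ι → ℝ) :
    posInertia (U * diagonal (fun i => (d i : ℂ)) * Uᴴ) = Fintype.card {i // 0 < d i} := by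
  classical
  unfold posInertia
  rw [charpoly_roots_conj_diagonal hU, Multiset.countP_map, Fintype.card_subtype]
  simp [Finset.card, Finset.filter]

theorem negInertia_conj_diagonal {U : Matrix ι ι ℂ} (hU : Uᴴ * U = 1) (d : ι → ℝ) :
    negInertia (U * diagonal (fun i => (d i : ℂ)) * Uᴴ) = Fintype.card {i // d i < 0} := by
  classical
  unfold negInertia
  rw [charpoly_roots_conj_diagonal hU, Multiset.countP_map, Fintype.card_subtype]
  have h : ∀ i, (d i : ℂ) < 0 ↔ d i < 0 := fun i => by exact_mod_cast Iff.rfl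
  simp [Finset.card, Finset.filter, h]

theorem exists_conj_diagonal {H : Matrix ι ι ℂ} (hH : H.IsHermitian) :
    ∃ (U : Matrix ι ι ℂ) (d : ι → ℝ), Uᴴ * U = 1 ∧ U * Uᴴ = 1 ∧
      H = U * diagonal (fun i => (d i : ℂ)) * Uᴴ :=
  ⟨hH.eigenvectorUnitary, hH.eigenvalues, Unitary.coe_star_mul_self _,
    Unitary.coe_mul_star_self _, hH.spectral_theorem⟩

theorem negInertia_eq_posInertia_neg {H : Matrix ι ι ℂ} (hH : H.IsHermitian) :
    negInertia H = posInertia (-H) := by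
  obtain ⟨U, d, hU, -, rfl⟩ := exists_conj_diagonal hH
  have h : -(U * diagonal (fun i => (d i : ℂ)) * Uᴴ)
      = U * diagonal (fun i => (((-d i : ℝ)) : ℂ)) * Uᴴ := by
    have : diagonal (fun i => (((-d i : ℝ)) : ℂ)) = -diagonal (fun i => (d i : ℂ)) := by
      simp [diagonal_neg]
    rw [this, Matrix.mul_neg, Matrix.neg_mul]
  rw [h, negInertia_conj_diagonal hU, posInertia_conj_diagonal hU (fun i => -d i)]
  simp

theorem posInertia_eq_negInertia_neg {H : Matrix ι ι ℂ} (hH : H.IsHermitian) :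
    posInertia H = negInertia (-H) := by
  rw [negInertia_eq_posInertia_neg hH.neg, neg_neg]

theorem posInertia_add_negInertia {H : Matrix ι ι ℂ} (hH : H.IsHermitian) :
    posInertia H + negInertia H = H.rank := by
  obtain ⟨U, d, hU, hU', rfl⟩ := exists_conj_diagonal hH
  have hdet : IsUnit U := IsUnit.of_mul_eq_one _ hU'
  have hdet' : IsUnit Uᴴ := IsUnit.of_mul_eq_one _ hU
  rw [posInertia_conj_diagonal hU, negInertia_conj_diagonal hU,
    rank_mul_eq_left_of_isUnit_det _ _ ((isUnit_iff_isUnit_det _).1 hdet'),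
    rank_mul_eq_right_of_isUnit_det _ _ ((isUnit_iff_isUnit_det _).1 hdet), rank_diagonal]
  rw [Fintype.card_subtype, Fintype.card_subtype, Fintype.card_subtype, ← Finset.card_union_of_disjoint]
  · congr 1
    ext i
    simp [lt_or_lt_iff_ne, ne_comm]
  · rw [Finset.disjoint_filter]
    intro i _ h1 h2
    exact lt_asymm h1 h2

/-- The columns of `V` are the eigenvectors with positive eigenvalue. -/
theorem exists_posDef_compression {H : Matrix ι ι ℂ} (hH : H.IsHermitian) :
    ∃ V : Matrix ι (Fin (posInertia H)) ℂ, (Vᴴ * H * V).PosDef := by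
  obtain ⟨U, d, hU, hU', rfl⟩ := exists_conj_diagonal hH
  have hc : Fintype.card (Fin (posInertia (U * diagonal (fun i => (d i : ℂ)) * Uᴴ)))
      = Fintype.card {i // 0 < d i} := by
    rw [Fintype.card_fin, posInertia_conj_diagonal hU]
  let e := Fintype.equivOfCardEq hc
  refine ⟨U * (1 : Matrix ι ι ℂ).submatrix id (fun j => (e j : ι)), ?_⟩
  set S := (1 : Matrix ι ι ℂ).submatrix id (fun j => (e j : ι)) with hS
  have h : (U * S)ᴴ * (U * diagonal (fun i => (d i : ℂ)) * Uᴴ) * (U * S)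
      = diagonal (fun j => (d (e j) : ℂ)) := by
    calc _ = Sᴴ * (Uᴴ * U) * diagonal (fun i => (d i : ℂ)) * (Uᴴ * U) * S := by
          simp only [conjTranspose_mul, Matrix.mul_assoc]
      _ = _ := by
          rw [hU, Matrix.mul_one, Matrix.mul_one]
          ext j k
          rw [Matrix.mul_apply]
          simp only [hS, conjTranspose_submatrix, conjTranspose_one, Matrix.mul_diagonal,
            submatrix_apply, id, Matrix.one_apply, diagonal_apply]
          by_cases hjk : j = k
          · subst hjk; simp
          · have : (e j : ι) ≠ e k := fun h => hjk (e.injective (Subtype.ext h))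
            simp [hjk, this]
  rw [h]
  exact PosDef.diagonal fun j => by exact_mod_cast (e j).2

omit [DecidableEq κ] in
-- If all coordinates of `V *ᵥ y` along the positive eigenvectors vanish, the form is nonpositive
-- there, so `y = 0`. Taking those coordinates is thus injective.
theorem card_le_posInertia {H : Matrix ι ι ℂ} (hH : H.IsHermitian) (V : Matrix ι κ ℂ)
    (hV : (Vᴴ * H * V).PosDef) : Fintype.card κ ≤ posInertia H := by
  obtain ⟨U, d, hU, hU', rfl⟩ := exists_conj_diagonal hH
  rw [posInertia_conj_diagonal hU]
  refine card_le_of_mulVec_injective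
    (V := (Uᴴ * V).submatrix (fun i : {i // 0 < d i} => (i : ι)) id) fun y hy => ?_
  by_contra hne
  have hpos := hV.dotProduct_mulVec_pos hne
  set w := (Uᴴ * V) *ᵥ y with hw
  have hwi : ∀ i, 0 < d i → w i = 0 := fun i hi => congrFun hy ⟨i, hi⟩
  have hform : star y ⬝ᵥ ((Vᴴ * (U * diagonal (fun i => (d i : ℂ)) * Uᴴ) * V) *ᵥ y)
      = ((∑ i, d i * Complex.normSq (w i) : ℝ) : ℂ) := by
    have h1 : (Vᴴ * (U * diagonal (fun i => (d i : ℂ)) * Uᴴ) * V) *ᵥ y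
        = (Uᴴ * V)ᴴ *ᵥ (diagonal (fun i => (d i : ℂ)) *ᵥ w) := by
      simp only [hw, mulVec_mulVec, conjTranspose_mul, conjTranspose_conjTranspose,
        Matrix.mul_assoc]
    rw [h1, dotProduct_mulVec, ← star_mulVec, ← hw]
    simp only [dotProduct, mulVec_diagonal, Pi.star_apply]
    push_cast
    refine Finset.sum_congr rfl fun i _ => ?_
    rw [Complex.normSq_eq_conj_mul_self]
    simp only [RCLike.star_def]
    ring
  rw [hform] at hpos
  have hpos' : (0 : ℝ) < ∑ i, d i * Complex.normSq (w i) := by exact_mod_cast hpos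
  refine absurd hpos' (not_lt.2 (Finset.sum_nonpos fun i _ => ?_))
  by_cases hi : 0 < d i
  · simp [hwi i hi]
  · exact mul_nonpos_of_nonpos_of_nonneg (not_lt.1 hi) (Complex.normSq_nonneg _)

/-- Inertia does not increase under compression. -/
theorem posInertia_conj_le {H : Matrix ι ι ℂ} (hH : H.IsHermitian) (P : Matrix ι κ ℂ) :
    posInertia (Pᴴ * H * P) ≤ posInertia H := by
  obtain ⟨V, hV⟩ := exists_posDef_compression (isHermitian_conjTranspose_mul_mul P hH)
  have h := card_le_posInertia hH (P * V) (by
    simpa only [conjTranspose_mul, Matrix.mul_assoc] using hV)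
  simpa using h

theorem posInertia_mono {H K : Matrix ι ι ℂ} (hH : H.IsHermitian) (hHK : (K - H).PosSemidef) :
    posInertia H ≤ posInertia K := by
  obtain ⟨V, hV⟩ := exists_posDef_compression hH
  have hK : K.IsHermitian := by simpa using hHK.isHermitian.add hH
  have h := card_le_posInertia hK V (by
    have := hV.add_posSemidef (hHK.conjTranspose_mul_mul_same V)
    rwa [← Matrix.add_mul, ← Matrix.mul_add, add_sub_cancel] at this)
  simpa using h

theorem posInertia_fromBlocks_diagonal (H : Matrix ι ι ℂ) (K : Matrix κ κ ℂ) :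
    posInertia (fromBlocks H 0 0 K) = posInertia H + posInertia K := by
  unfold posInertia
  rw [charpoly_fromBlocks_zero₁₂, Polynomial.roots_mul, Multiset.countP_add]
  exact mul_ne_zero H.charpoly_monic.ne_zero K.charpoly_monic.ne_zero

theorem posInertia_le_card {H : Matrix ι ι ℂ} (hH : H.IsHermitian) :
    posInertia H ≤ Fintype.card ι := by
  have := posInertia_add_negInertia hH
  have := H.rank_le_card_width
  omega

theorem posDef_iff_posInertia {H : Matrix ι ι ℂ} (hH : H.IsHermitian) :
    H.PosDef ↔ posInertia H = Fintype.card ι := by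
  constructor
  · intro h
    exact le_antisymm (posInertia_le_card hH) (card_le_posInertia hH 1 (by simpa using h))
  · intro h
    rw [hH.posDef_iff_eigenvalues_pos]
    have h1 := posInertia_conj_diagonal (U := hH.eigenvectorUnitary) (Unitary.coe_star_mul_self _)
      hH.eigenvalues
    have h2 := hH.spectral_theorem
    rw [Unitary.conjStarAlgAut_apply] at h2
    erw [← h2, h, Fintype.card_subtype] at h1
    intro i
    have h3 := (Finset.card_eq_iff_eq_univ _).1 h1.symm
    simpa using h3.symm.subset (Finset.mem_univ i)

theorem posSemidef_iff_negInertia {H : Matrix ι ι ℂ} (hH : H.IsHermitian) :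
    H.PosSemidef ↔ negInertia H = 0 := by
  rw [hH.posSemidef_iff_eigenvalues_nonneg]
  have h1 := negInertia_conj_diagonal (U := hH.eigenvectorUnitary) (Unitary.coe_star_mul_self _)
    hH.eigenvalues
  have h2 := hH.spectral_theorem
  rw [Unitary.conjStarAlgAut_apply] at h2
  erw [← h2] at h1
  rw [h1, Fintype.card_eq_zero_iff, isEmpty_subtype]
  simp [Pi.le_def]

end Inertia

/-! ### Congruence, small perturbations and inner inverses. -/

section Congruence

variable {ι κ : Type*} [Fintype ι] [DecidableEq ι] [Fintype κ] [DecidableEq κ]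

/-- Each matrix is a compression of the other. Separate index types allow blocks to be regrouped. -/
theorem posInertia_congr {H : Matrix ι ι ℂ} {D : Matrix κ κ ℂ} (hH : H.IsHermitian)
    (P : Matrix ι κ ℂ) (P' : Matrix κ ι ℂ) (hP : P * P' = 1) (hD : Pᴴ * H * P = D) :
    posInertia H = posInertia D := by
  have hDH : D.IsHermitian := hD ▸ isHermitian_conjTranspose_mul_mul P hH
  refine le_antisymm ?_ (hD ▸ posInertia_conj_le hH P)
  have h : P'ᴴ * D * P' = H := by
    calc P'ᴴ * D * P' = (P * P')ᴴ * H * (P * P') := by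
          simp only [← hD, conjTranspose_mul, Matrix.mul_assoc]
      _ = H := by simp [hP]
  exact h ▸ posInertia_conj_le hDH P'

theorem negInertia_congr {H : Matrix ι ι ℂ} {D : Matrix κ κ ℂ} (hH : H.IsHermitian)
    (P : Matrix ι κ ℂ) (P' : Matrix κ ι ℂ) (hP : P * P' = 1) (hD : Pᴴ * H * P = D) :
    negInertia H = negInertia D := by
  have hDH : D.IsHermitian := hD ▸ isHermitian_conjTranspose_mul_mul P hH
  rw [negInertia_eq_posInertia_neg hH, negInertia_eq_posInertia_neg hDH]
  exact posInertia_congr hH.neg P P' hP (by rw [Matrix.mul_neg, Matrix.neg_mul, hD])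

theorem negInertia_fromBlocks_diagonal (H : Matrix ι ι ℂ) (K : Matrix κ κ ℂ) :
    negInertia (fromBlocks H 0 0 K) = negInertia H + negInertia K := by
  unfold negInertia
  rw [charpoly_fromBlocks_zero₁₂, Polynomial.roots_mul, Multiset.countP_add]
  exact mul_ne_zero H.charpoly_monic.ne_zero K.charpoly_monic.ne_zero

omit [DecidableEq ι] in
/-- Positive definiteness survives a small Hermitian perturbation. -/
theorem exists_posDef_add_smul {S N : Matrix ι ι ℂ} (hS : S.PosDef) (hN : N.IsHermitian) :
    ∃ ε : ℝ, 0 < ε ∧ (S + (ε : ℂ) • N).PosDef := by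
  classical
  obtain ⟨U, d, hU, hU', hd⟩ := exists_conj_diagonal hN
  obtain ⟨U₂, e, hU₂, hU₂', he⟩ := exists_conj_diagonal hS.isHermitian
  have hepos : ∀ i, 0 < e i := by
    have h := hS.conjTranspose_mul_mul_same (B := U₂)
      (mulVec_injective_of_isUnit (IsUnit.of_mul_eq_one _ hU₂'))
    have h' : U₂ᴴ * S * U₂ = diagonal (fun i => (e i : ℂ)) := by
      rw [he]
      calc _ = (U₂ᴴ * U₂) * diagonal (fun i => (e i : ℂ)) * (U₂ᴴ * U₂) := by
            simp only [Matrix.mul_assoc]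
        _ = _ := by simp [hU₂]
    rw [h', posDef_diagonal_iff] at h
    exact fun i => by exact_mod_cast h i
  -- The eigenvalue bounds give S ≽ 1/b' and N ≽ -c', so ε = 1/(2b'c') leaves S + εN ≽ 1/(2b'). The
  -- maxima with 1 keep both constants positive.
  obtain ⟨c, hc⟩ := Finite.exists_le (fun i => -d i)
  obtain ⟨b, hb⟩ := Finite.exists_le (fun i => (e i)⁻¹)
  set c' := max c 1
  set b' := max b 1
  have hc' : 0 < c' := lt_max_of_lt_right one_pos
  have hb' : 0 < b' := lt_max_of_lt_right one_pos
  refine ⟨(2 * b' * c')⁻¹, by positivity, ?_⟩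
  have key : S + (((2 * b' * c' : ℝ)⁻¹ : ℝ) : ℂ) • N
      = U₂ * diagonal (fun i => ((e i - b'⁻¹ : ℝ) : ℂ)) * U₂ᴴ
        + (((2 * b' * c' : ℝ)⁻¹ : ℝ) : ℂ) • (U * diagonal (fun i => ((d i + c' : ℝ) : ℂ)) * Uᴴ)
        + (((2 * b')⁻¹ : ℝ) : ℂ) • (1 : Matrix ι ι ℂ) := by
    have h1 : U₂ * diagonal (fun i => ((e i - b'⁻¹ : ℝ) : ℂ)) * U₂ᴴ
        = S - ((b'⁻¹ : ℝ) : ℂ) • (1 : Matrix ι ι ℂ) := by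
      have : diagonal (fun i => ((e i - b'⁻¹ : ℝ) : ℂ))
          = diagonal (fun i => (e i : ℂ)) - ((b'⁻¹ : ℝ) : ℂ) • (1 : Matrix ι ι ℂ) := by
        ext i j; by_cases h : i = j <;> simp [h]
      rw [this, Matrix.mul_sub, Matrix.sub_mul, ← he]
      simp [hU₂']
    have h2 : U * diagonal (fun i => ((d i + c' : ℝ) : ℂ)) * Uᴴ
        = N + (c' : ℂ) • (1 : Matrix ι ι ℂ) := by
      have : diagonal (fun i => ((d i + c' : ℝ) : ℂ))
          = diagonal (fun i => (d i : ℂ)) + (c' : ℂ) • (1 : Matrix ι ι ℂ) := by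
        ext i j; by_cases h : i = j <;> simp [h]
      rw [this, Matrix.mul_add, Matrix.add_mul, ← hd]
      simp [hU']
    rw [h1, h2, smul_add, smul_smul]
    have h3 : (((2 * b' * c' : ℝ)⁻¹ : ℝ) : ℂ) * (c' : ℂ) = (((2 * b')⁻¹ : ℝ) : ℂ) := by
      rw [← Complex.ofReal_mul]
      congr 1
      field_simp
    have h4 : ((b'⁻¹ : ℝ) : ℂ) = (((2 * b')⁻¹ : ℝ) : ℂ) + (((2 * b')⁻¹ : ℝ) : ℂ) := by
      rw [← Complex.ofReal_add]
      congr 1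
      field_simp
      norm_num
    rw [h3, h4, add_smul]
    abel
  rw [key]
  refine PosDef.posSemidef_add (PosSemidef.add ?_ (PosSemidef.smul ?_ ?_)) (PosDef.one.smul ?_)
  · refine (PosSemidef.diagonal fun i => ?_).mul_mul_conjTranspose_same U₂
    have : b'⁻¹ ≤ e i := inv_le_of_inv_le₀ (hepos i) ((hb i).trans (le_max_left _ _))
    show (0 : ℂ) ≤ ((e i - b'⁻¹ : ℝ) : ℂ)
    exact_mod_cast sub_nonneg.2 this
  · refine (PosSemidef.diagonal fun i => ?_).mul_mul_conjTranspose_same U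
    have : 0 ≤ d i + c' := by linarith [hc i, le_max_left c 1]
    show (0 : ℂ) ≤ ((d i + c' : ℝ) : ℂ)
    exact_mod_cast this
  · have : (0 : ℝ) ≤ (2 * b' * c')⁻¹ := by positivity
    exact_mod_cast this
  · have : (0 : ℝ) < (2 * b')⁻¹ := by positivity
    exact_mod_cast this

omit [DecidableEq κ] in
/-- A right factor realising the rank of a matrix by an injective product. -/
theorem exists_posDef_gram (T : Matrix κ ι ℂ) :
    ∃ W : Matrix ι (Fin T.rank) ℂ, ((T * W)ᴴ * (T * W)).PosDef := by
  have hpsd := posSemidef_conjTranspose_mul_self T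
  have h := posInertia_add_negInertia hpsd.isHermitian
  rw [(posSemidef_iff_negInertia hpsd.isHermitian).1 hpsd, rank_conjTranspose_mul_self,
    add_zero] at h
  obtain ⟨W, hW⟩ : ∃ W : Matrix ι (Fin T.rank) ℂ, (Wᴴ * (Tᴴ * T) * W).PosDef :=
    h ▸ exists_posDef_compression hpsd.isHermitian
  exact ⟨W, by simpa only [conjTranspose_mul, Matrix.mul_assoc] using hW⟩

omit [DecidableEq κ] in
/-- Every matrix `T` has an inner inverse `G` such that `T * G` is an orthogonal projection. -/
theorem exists_orthogonal_inner_inverse (T : Matrix κ ι ℂ) :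
    ∃ G : Matrix ι κ ℂ, (T * G).IsHermitian ∧ T * G * T = T := by
  obtain ⟨U, d, hU, hU', hd⟩ := exists_conj_diagonal (isHermitian_conjTranspose_mul_self T)
  -- Since `0⁻¹ = 0`, this is the pseudoinverse of `Tᴴ * T`, with no case split on zero eigenvalues.
  set J := U * diagonal (fun i => ((d i)⁻¹ : ℂ)) * Uᴴ with hJ
  have hJH : Jᴴ = J := by
    have : star (fun i => ((d i : ℂ))⁻¹) = fun i => ((d i : ℂ))⁻¹ := by
      ext i; simp
    simp only [hJ, conjTranspose_mul, conjTranspose_conjTranspose, diagonal_conjTranspose, this,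
      Matrix.mul_assoc]
  have hinner : Tᴴ * T * J * (Tᴴ * T) = Tᴴ * T := by
    rw [hd, hJ]
    calc _ = U * (diagonal (fun i => (d i : ℂ)) * (Uᴴ * U) * diagonal (fun i => ((d i)⁻¹ : ℂ))
          * (Uᴴ * U) * diagonal (fun i => (d i : ℂ))) * Uᴴ := by simp only [Matrix.mul_assoc]
      _ = _ := by
        rw [hU, Matrix.mul_one, Matrix.mul_one, diagonal_mul_diagonal, diagonal_mul_diagonal]
        congr 3
        ext i
        exact mul_inv_mul_cancel (d i : ℂ)
  refine ⟨J * Tᴴ, ?_, ?_⟩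
  · rw [IsHermitian, conjTranspose_mul, conjTranspose_mul, conjTranspose_conjTranspose, hJH,
      Matrix.mul_assoc]
  · rw [← sub_eq_zero, ← conjTranspose_mul_self_eq_zero]
    have h : Tᴴ * (T * (J * Tᴴ) * T - T) = 0 := by
      rw [Matrix.mul_sub, sub_eq_zero]
      simpa only [Matrix.mul_assoc] using hinner
    have h2 : (T * (J * Tᴴ) * T - T)ᴴ = (J * Tᴴ * T - 1)ᴴ * Tᴴ := by
      rw [← conjTranspose_mul, Matrix.mul_sub, Matrix.mul_one, Matrix.mul_assoc T]
    rw [h2, Matrix.mul_assoc, h, Matrix.mul_zero]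

end Congruence

/-! ### Inertia and rank of bordered matrices. -/

section Bordered

variable {m n : ℕ} {A : Matrix (Fin m) (Fin n) ℂ} {B C M : Matrix (Fin m) (Fin m) ℂ}

theorem bordered_isHermitian (hM : M.IsHermitian) : (bordered A M).IsHermitian :=
  hM.fromBlocks rfl isHermitian_zero

theorem compression_bordered {κ : Type*} (M : Matrix (Fin m) (Fin m) ℂ)
    (X : Matrix (Fin m) κ ℂ) (Z : Matrix (Fin n) κ ℂ) :
    (fromRows X Z)ᴴ * bordered A M * fromRows X Z
      = Xᴴ * M * X + Xᴴ * A * Z + Zᴴ * Aᴴ * X := by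
  rw [bordered, conjTranspose_fromRows_eq_fromCols_conjTranspose, Matrix.mul_assoc,
    fromBlocks_mul_fromRows, fromCols_mul_fromRows]
  simp only [Matrix.mul_add, Matrix.zero_mul, add_zero, Matrix.mul_assoc]

/-- The border can clear AQA*: adding half of it through the rows and half through the columns is a
congruence. -/
theorem bordered_shift (hM : M.IsHermitian) {Q : Matrix (Fin n) (Fin n) ℂ} (hQ : Q.IsHermitian) :
    posInertia (bordered A (M + A * Q * Aᴴ)) = posInertia (bordered A M) ∧
      negInertia (bordered A (M + A * Q * Aᴴ)) = negInertia (bordered A M) := by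
  have hinv : (fromBlocks 1 0 ((2⁻¹ : ℂ) • (Q * Aᴴ)) 1 :
      Matrix (Fin m ⊕ Fin n) (Fin m ⊕ Fin n) ℂ) * fromBlocks 1 0 (-((2⁻¹ : ℂ) • (Q * Aᴴ))) 1
      = 1 := by
    rw [fromBlocks_multiply]
    simp
  have hcong : (fromBlocks 1 0 ((2⁻¹ : ℂ) • (Q * Aᴴ)) 1 :
      Matrix (Fin m ⊕ Fin n) (Fin m ⊕ Fin n) ℂ)ᴴ * bordered A M
        * fromBlocks 1 0 ((2⁻¹ : ℂ) • (Q * Aᴴ)) 1 = bordered A (M + A * Q * Aᴴ) := by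
    rw [bordered, bordered, fromBlocks_conjTranspose, fromBlocks_multiply, fromBlocks_multiply]
    congr 1
    · simp only [conjTranspose_one, Matrix.one_mul, Matrix.mul_one, conjTranspose_smul,
        conjTranspose_mul, conjTranspose_conjTranspose, hQ.eq, Matrix.smul_mul, Matrix.mul_smul,
        Matrix.mul_assoc]
      simp
      module
    · simp
    · simp
    · simp
  exact ⟨(posInertia_congr (bordered_isHermitian hM) _ _ hinv hcong).symm,
    (negInertia_congr (bordered_isHermitian hM) _ _ hinv hcong).symm⟩

theorem negInertia_bordered (hM : M.IsHermitian) :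
    negInertia (bordered A M) = posInertia (bordered A (-M)) := by
  rw [negInertia_eq_posInertia_neg (bordered_isHermitian hM)]
  refine posInertia_congr (bordered_isHermitian hM).neg (fromBlocks 1 0 0 (-1))
    (fromBlocks 1 0 0 (-1)) ?_ ?_
  · rw [fromBlocks_multiply]
    simp
  · rw [bordered, bordered, fromBlocks_conjTranspose, fromBlocks_neg, fromBlocks_multiply,
      fromBlocks_multiply]
    simp

theorem posInertia_le_bordered (hM : M.IsHermitian) :
    posInertia M ≤ posInertia (bordered A M) := by
  have h := posInertia_conj_le (bordered_isHermitian (A := A) hM) (fromRows (1 : Matrix (Fin m) (Fin m) ℂ) 0)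
  rw [compression_bordered] at h
  simpa using h

/-- A large positive semidefinite `Q` makes `M + A Q A*` as positive as the bordered matrix. -/
theorem exists_posInertia_bordered_le (hM : M.IsHermitian) :
    ∃ Q : Matrix (Fin n) (Fin n) ℂ, Q.PosSemidef ∧
      posInertia (bordered A M) ≤ posInertia (M + A * Q * Aᴴ) := by
  obtain ⟨V, hV⟩ := exists_posDef_compression (bordered_isHermitian (A := A) hM)
  obtain ⟨X, Z, rfl⟩ : ∃ X Z, V = fromRows X Z := ⟨_, _, (fromRows_toRows V).symm⟩
  rw [compression_bordered] at hV
  obtain ⟨ε, hε, hpos⟩ := exists_posDef_add_smul hV (isHermitian_conjTranspose_mul_self Z).neg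
  have hεc : (ε : ℂ) ≠ 0 := by exact_mod_cast hε.ne'
  have hQ : ((ε⁻¹ : ℝ) : ℂ) • (1 : Matrix (Fin n) (Fin n) ℂ) |>.PosSemidef :=
    PosSemidef.one.smul (by exact_mod_cast (inv_pos.2 hε).le)
  refine ⟨_, hQ, ?_⟩
  have hF : (M + A * (((ε⁻¹ : ℝ) : ℂ) • (1 : Matrix (Fin n) (Fin n) ℂ)) * Aᴴ).IsHermitian :=
    hM.add (hQ.mul_mul_conjTranspose_same A).isHermitian
  -- Completing the square: adding ε⁻¹(A*X - εZ)*(A*X - εZ) to the perturbed form cancels the cross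
  -- terms and εZ*Z, leaving X*(M + ε⁻¹AA*)X.
  have h := card_le_posInertia hF X (by
    have h1 := hpos.add_posSemidef ((posSemidef_conjTranspose_mul_self (Aᴴ * X - (ε : ℂ) • Z)).smul
      (a := ((ε⁻¹ : ℝ) : ℂ)) (by exact_mod_cast (inv_pos.2 hε).le))
    convert h1 using 1
    simp only [conjTranspose_sub, conjTranspose_mul, conjTranspose_smul,
      conjTranspose_conjTranspose, Matrix.mul_add, Matrix.add_mul, Matrix.mul_sub, Matrix.sub_mul,
      Matrix.mul_smul, Matrix.smul_mul, smul_sub, smul_smul, Complex.ofReal_inv,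
      RCLike.star_def, Complex.conj_ofReal, inv_mul_cancel₀ hεc, Matrix.mul_one, smul_neg,
      one_smul, inv_mul_cancel_left₀ hεc, Matrix.mul_assoc]
    abel)
  simpa using h

theorem rank_fromCols_le_inertia (hM : M.IsHermitian) :
    (fromCols A M).rank ≤ negInertia M + posInertia (bordered A M) := by
  obtain ⟨W, hW⟩ := exists_posDef_gram (fromCols A M)
  obtain ⟨Z, X, rfl⟩ : ∃ Z X, W = fromRows Z X := ⟨_, _, (fromRows_toRows W).symm⟩
  rw [fromCols_mul_fromRows] at hW
  set G := A * Z + M * X with hG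
  have hN : (Xᴴ * A * Z + Zᴴ * Aᴴ * X).IsHermitian := by
    rw [IsHermitian]
    simp only [conjTranspose_add, conjTranspose_mul, conjTranspose_conjTranspose, Matrix.mul_assoc]
    abel
  obtain ⟨ε, hε, hpos⟩ := exists_posDef_add_smul hW hN
  rw [negInertia_eq_posInertia_neg hM, add_comm, ← posInertia_fromBlocks_diagonal]
  -- The test columns are chosen so that the terms X*MX and G*MG cancel between the two blocks. What
  -- remains is 8ε(G*G + εN), where N = X*AZ + Z*A*X.
  have h := card_le_posInertia
    (H := fromBlocks (bordered A M) 0 0 (-M))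
    ((bordered_isHermitian hM).fromBlocks (by simp) hM.neg)
    (fromRows (fromRows ((2 * ε : ℂ) • X + G) ((4 * ε : ℂ) • Z)) ((2 * ε : ℂ) • X - G)) (by
    have h1 := hpos.smul (a := ((8 * ε : ℝ) : ℂ)) (by exact_mod_cast (by positivity))
    convert h1 using 1
    rw [conjTranspose_fromRows_eq_fromCols_conjTranspose, Matrix.mul_assoc,
      fromBlocks_mul_fromRows, fromCols_mul_fromRows, Matrix.zero_mul, Matrix.zero_mul, add_zero,
      zero_add, ← Matrix.mul_assoc, compression_bordered]
    have hGH : Gᴴ * G = (2⁻¹ : ℂ) • (Gᴴ * A * Z + Gᴴ * M * X + Zᴴ * Aᴴ * G + Xᴴ * M * G) := by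
      have e1 : Gᴴ * G = Gᴴ * A * Z + Gᴴ * M * X := by
        conv_lhs => rw [hG, Matrix.mul_add, ← hG]
        simp only [Matrix.mul_assoc]
      have e2 : Gᴴ * G = Zᴴ * Aᴴ * G + Xᴴ * M * G := by
        conv_lhs => rw [hG, conjTranspose_add, Matrix.add_mul, ← hG]
        simp only [conjTranspose_mul, hM.eq]
      rw [add_assoc, ← e2, ← e1]
      module
    rw [hGH]
    simp only [conjTranspose_sub, conjTranspose_add, conjTranspose_smul,
      Matrix.mul_add, Matrix.add_mul, Matrix.mul_sub, Matrix.sub_mul, Matrix.mul_neg,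
      Matrix.neg_mul, Matrix.mul_smul, Matrix.smul_mul, Matrix.mul_assoc, smul_add]
    simp only [star_mul', star_ofNat, RCLike.star_def, Complex.conj_ofReal]
    push_cast
    module)
  simpa using h

theorem rank_fromCols_add_le (S : Matrix (Fin n) (Fin m) ℂ) :
    (fromCols A (M + A * S)).rank ≤ (fromCols A M).rank := by
  have h : fromCols A (M + A * S) = fromCols A M *
      (fromBlocks 1 S 0 1 : Matrix (Fin n ⊕ Fin m) (Fin n ⊕ Fin m) ℂ) := by
    rw [fromCols_mul_fromBlocks]
    simp [add_comm]
  rw [h]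
  exact rank_mul_le_left _ _

theorem rank_fromCols_add (S : Matrix (Fin n) (Fin m) ℂ) :
    (fromCols A (M + A * S)).rank = (fromCols A M).rank := by
  refine le_antisymm (rank_fromCols_add_le S) ?_
  simpa [Matrix.mul_neg] using rank_fromCols_add_le (A := A) (M := M + A * S) (-S)

theorem rank_fromCols_neg : (fromCols A (-M)).rank = (fromCols A M).rank := by
  have h (N : Matrix (Fin m) (Fin m) ℂ) : (fromCols A (-N)).rank ≤ (fromCols A N).rank := by
    have : fromCols A (-N) = fromCols A N *
        (fromBlocks 1 0 0 (-1) : Matrix (Fin n ⊕ Fin m) (Fin n ⊕ Fin m) ℂ) := by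
      rw [fromCols_mul_fromBlocks]
      simp
    rw [this]
    exact rank_mul_le_left _ _
  refine le_antisymm (h M) ?_
  simpa using h (-M)

theorem rank_le_rank_fromCols : M.rank ≤ (fromCols A M).rank := by
  have h : M = fromCols A M * (fromRows 0 1 : Matrix (Fin n ⊕ Fin m) (Fin m) ℂ) := by
    rw [fromCols_mul_fromRows]
    simp
  conv_lhs => rw [h]
  exact rank_mul_le_left _ _

end Bordered

/-! ### Rank-lowering updates, the minimal solution and the splitting of K₁. -/

section Extremal

variable {m n : ℕ} {A : Matrix (Fin m) (Fin n) ℂ} {B C M : Matrix (Fin m) (Fin m) ℂ}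

/-- Put a negative subspace Y of M beside a positive subspace (X, Z) of the bordered matrix; `[A,
M]` is injective on the result. A kernel vector gives M(y + x) = -Az, and the bordered form at (x,
z) becomes y*My - (y + x)*M(y + x) ≤ 0. This kills the second component; then My = 0 kills the
first. -/
theorem inertia_le_rank_fromCols (hM : M.IsHermitian)
    (h : ∀ (x : Fin m → ℂ) (z : Fin n → ℂ), M *ᵥ x = A *ᵥ z → 0 ≤ star x ⬝ᵥ (M *ᵥ x)) :
    negInertia M + posInertia (bordered A M) ≤ (fromCols A M).rank := by
  rw [negInertia_eq_posInertia_neg hM]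
  obtain ⟨Y, hY⟩ := exists_posDef_compression hM.neg
  obtain ⟨V, hV⟩ := exists_posDef_compression (bordered_isHermitian (A := A) hM)
  obtain ⟨X, Z, rfl⟩ : ∃ X Z, V = fromRows X Z := ⟨_, _, (fromRows_toRows V).symm⟩
  rw [compression_bordered] at hV
  have key := card_le_rank_of_mulVec_injective (fromCols A M) (V := fromBlocks 0 Z Y X)
    (fun w hw => ?_)
  · simpa using key
  obtain ⟨p, q, rfl⟩ : ∃ p q, w = Sum.elim p q := ⟨_, _, (Sum.elim_comp_inl_inr w).symm⟩
  have hrel : M *ᵥ (Y *ᵥ p + X *ᵥ q) = A *ᵥ (-(Z *ᵥ q)) := by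
    rw [← mulVec_mulVec, fromBlocks_mulVec, fromCols_mulVec] at hw
    simp only [Sum.elim_comp_inl, Sum.elim_comp_inr, zero_mulVec, zero_add] at hw
    rw [mulVec_neg, eq_neg_iff_add_eq_zero, add_comm]
    exact hw
  set x := X *ᵥ q with hx
  set y := Y *ᵥ p with hy
  set z := Z *ᵥ q with hz
  have hsum := h _ _ hrel
  have hAz : A *ᵥ z = -(M *ᵥ (y + x)) := by rw [hrel, mulVec_neg, neg_neg]
  have hYform : star p ⬝ᵥ ((Yᴴ * (-M) * Y) *ᵥ p) = -(star y ⬝ᵥ (M *ᵥ y)) := by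
    rw [← mulVec_mulVec, ← mulVec_mulVec, ← hy, dotProduct_mulVec, ← star_mulVec, ← hy, neg_mulVec,
      dotProduct_neg]
  have hadj : ∀ u v : Fin m → ℂ, star (M *ᵥ u) ⬝ᵥ v = star u ⬝ᵥ (M *ᵥ v) := fun u v => by
    rw [star_mulVec, hM.eq, dotProduct_mulVec]
  have hVform : star q ⬝ᵥ ((Xᴴ * M * X + Xᴴ * A * Z + Zᴴ * Aᴴ * X) *ᵥ q)
      = star y ⬝ᵥ (M *ᵥ y) - star (y + x) ⬝ᵥ (M *ᵥ (y + x)) := by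
    have e1 : star q ⬝ᵥ ((Xᴴ * M * X) *ᵥ q) = star x ⬝ᵥ (M *ᵥ x) := by
      rw [← mulVec_mulVec, ← mulVec_mulVec, ← hx, dotProduct_mulVec, ← star_mulVec, ← hx]
    have e2 : star q ⬝ᵥ ((Xᴴ * A * Z) *ᵥ q) = star x ⬝ᵥ (A *ᵥ z) := by
      rw [← mulVec_mulVec, ← mulVec_mulVec, ← hz, dotProduct_mulVec, ← star_mulVec, ← hx]
    have e3 : star q ⬝ᵥ ((Zᴴ * Aᴴ * X) *ᵥ q) = star (A *ᵥ z) ⬝ᵥ x := by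
      rw [← conjTranspose_mul, ← mulVec_mulVec, ← hx, dotProduct_mulVec, ← star_mulVec,
        ← mulVec_mulVec, ← hz]
    rw [add_mulVec, add_mulVec, dotProduct_add, dotProduct_add, e1, e2, e3, hAz, star_neg,
      neg_dotProduct, hadj]
    simp only [mulVec_add, star_add, dotProduct_add, add_dotProduct, dotProduct_neg]
    ring
  have hyle : 0 ≤ -(star y ⬝ᵥ (M *ᵥ y)) := hYform ▸ hY.posSemidef.dotProduct_mulVec_nonneg p
  have hq : q = 0 := by
    by_contra hne
    have hpos := hV.dotProduct_mulVec_pos hne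
    rw [hVform] at hpos
    have h1 : star y ⬝ᵥ (M *ᵥ y) ≤ 0 := neg_nonneg.1 hyle
    exact absurd (hpos.trans_le (sub_nonpos.2 (h1.trans hsum))) (lt_irrefl _)
  have hp : p = 0 := by
    by_contra hne
    have hpos := hY.dotProduct_mulVec_pos hne
    have hx0 : x = 0 := by rw [hx, hq, mulVec_zero]
    have hz0 : z = 0 := by rw [hz, hq, mulVec_zero]
    rw [hx0, hz0, add_zero, neg_zero, mulVec_zero] at hrel
    rw [hYform, hrel, dotProduct_zero, neg_zero] at hpos
    exact lt_irrefl _ hpos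
  rw [hq, hp]
  ext (i | i) <;> rfl

/-- A negative vector `x` with `M x` in the range of `A` allows a rank-one update by
`A Q A*` that lowers the rank without raising the positive inertia. -/
theorem exists_rank_lt (hM : M.IsHermitian) {x : Fin m → ℂ} {z : Fin n → ℂ}
    (hxz : M *ᵥ x = A *ᵥ z) (hneg : ¬ 0 ≤ star x ⬝ᵥ (M *ᵥ x)) :
    ∃ Q : Matrix (Fin n) (Fin n) ℂ, Q.PosSemidef ∧
      posInertia (M + A * Q * Aᴴ) ≤ posInertia M ∧ (M + A * Q * Aᴴ).rank < M.rank := by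
  -- In the order on `ℂ`, the failure of `0 ≤ _` means negativity only once the number is known to
  -- be real.
  have hreal : star (star x ⬝ᵥ (M *ᵥ x)) = star x ⬝ᵥ (M *ᵥ x) := by
    rw [← star_dotProduct_star, star_star, star_mulVec, hM.eq, dotProduct_comm,
      dotProduct_mulVec, dotProduct_comm]
  obtain ⟨c, hc⟩ : ∃ c : ℝ, star x ⬝ᵥ (M *ᵥ x) = -(c : ℂ) :=
    ⟨-(star x ⬝ᵥ (M *ᵥ x)).re, by
      rw [Complex.ofReal_neg, neg_neg]; exact (Complex.conj_eq_iff_re.1 hreal).symm⟩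
  have hcpos : 0 < c := by
    rw [hc] at hneg
    by_contra h
    exact hneg (neg_nonneg.2 (by exact_mod_cast not_lt.1 h))
  have hc0 : (c : ℂ) ≠ 0 := by exact_mod_cast hcpos.ne'
  set a : ℂ := ((c⁻¹ : ℝ) : ℂ) with ha
  have hac : a * c = 1 := by rw [ha, Complex.ofReal_inv, inv_mul_cancel₀ hc0]
  have hstar : star a = a := Complex.conj_ofReal _
  have hQ : (a • (replicateCol Unit z * (replicateCol Unit z)ᴴ)).PosSemidef :=
    (posSemidef_self_mul_conjTranspose _).smul (by rw [ha]; exact_mod_cast (inv_pos.2 hcpos).le)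
  set x' := replicateCol Unit x with hx'
  set z' := replicateCol Unit z with hz'
  have hMx : M * x' = A * z' := by
    rw [hx', hz', ← replicateCol_mulVec, ← replicateCol_mulVec, hxz]
  have hxMx : x'ᴴ * (M * x') = (-c : ℂ) • (1 : Matrix Unit Unit ℂ) := by
    ext i j
    rw [hx', ← replicateCol_mulVec, Matrix.mul_apply]
    simp only [conjTranspose_apply, replicateCol_apply, Matrix.smul_apply, Matrix.one_apply_eq,
      smul_eq_mul, mul_one, ← hc]
    rfl
  have hxM : x'ᴴ * M = z'ᴴ * Aᴴ := by
    rw [← conjTranspose_mul, ← hMx, conjTranspose_mul, hM.eq]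
  -- The M-orthogonal projection that kills x. The update equals MP = P*MP: as a compression of M it
  -- does not raise i₊, and its kernel gains x.
  set P := (1 : Matrix (Fin m) (Fin m) ℂ) + a • (x' * (x'ᴴ * M)) with hP
  have hF : M + A * (a • (z' * z'ᴴ)) * Aᴴ = M * P := by
    rw [hP, Matrix.mul_add, Matrix.mul_one, hxM, Matrix.mul_smul M, ← Matrix.mul_assoc M x', hMx]
    simp only [Matrix.mul_smul, Matrix.smul_mul, Matrix.mul_assoc]
  have hPx : P * x' = 0 := by
    rw [hP, Matrix.add_mul, Matrix.one_mul, Matrix.smul_mul, Matrix.mul_assoc, Matrix.mul_assoc,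
      hxMx, Matrix.mul_smul, Matrix.mul_one, smul_smul, mul_neg, hac, neg_one_smul, add_neg_cancel]
  have hcong : Pᴴ * M * P = M * P := by
    have : Pᴴ = 1 + a • (M * x' * x'ᴴ) := by
      rw [hP]
      simp only [conjTranspose_add, conjTranspose_one, conjTranspose_smul, conjTranspose_mul,
        conjTranspose_conjTranspose, hM.eq, hstar]
    rw [this, Matrix.add_mul, Matrix.one_mul, Matrix.add_mul, Matrix.smul_mul, Matrix.smul_mul]
    have h0 : x'ᴴ * (M * P) = 0 := by
      have h1 : x'ᴴ * (M * P) = x'ᴴ * M + a • (x'ᴴ * (M * x') * (x'ᴴ * M)) := by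
        rw [hP]
        simp only [Matrix.mul_add, Matrix.mul_one, Matrix.mul_smul, Matrix.mul_assoc]
      rw [h1, hxMx, Matrix.smul_mul, Matrix.one_mul, smul_smul, mul_neg, hac, neg_one_smul,
        add_neg_cancel]
    rw [Matrix.mul_assoc (M * x'), Matrix.mul_assoc (M * x'), Matrix.mul_assoc x'ᴴ, h0, Matrix.mul_zero, smul_zero,
      add_zero]
  refine ⟨_, hQ, ?_, ?_⟩
  · rw [hF, ← hcong]
    exact posInertia_conj_le hM P
  · rw [hF]
    have hle : LinearMap.ker M.mulVecLin < LinearMap.ker (M * P).mulVecLin := by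
      refine SetLike.lt_iff_le_and_exists.2 ⟨fun v hv => ?_, x, ?_, ?_⟩
      · rw [LinearMap.mem_ker, mulVecLin_apply] at hv ⊢
        rw [hP, Matrix.mul_add, Matrix.mul_one, Matrix.mul_smul, add_mulVec, smul_mulVec,
          ← Matrix.mul_assoc, ← Matrix.mul_assoc, ← mulVec_mulVec, hv, mulVec_zero, smul_zero,
          add_zero]
      · rw [LinearMap.mem_ker, mulVecLin_apply, ← mulVec_mulVec]
        have : P *ᵥ x = 0 := by
          ext i
          exact congrFun (congrFun hPx i) ()
        rw [this, mulVec_zero]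
      · rw [LinearMap.mem_ker, mulVecLin_apply]
        intro h0
        rw [h0, dotProduct_zero] at hneg
        exact hneg le_rfl
    have h1 := Submodule.finrank_lt_finrank_of_lt hle
    have h2 := LinearMap.finrank_range_add_finrank_ker M.mulVecLin
    have h3 := LinearMap.finrank_range_add_finrank_ker (M * P).mulVecLin
    rw [Matrix.rank, Matrix.rank]
    omega

/-- Some update by `A Q A*`, `Q` positive semidefinite, keeps the positive inertia while bringing
the negative inertia down to its lower bound. -/
theorem exists_minimal_inertia (hM : M.IsHermitian) :
    ∃ Q : Matrix (Fin n) (Fin n) ℂ, Q.PosSemidef ∧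
      posInertia (M + A * Q * Aᴴ) ≤ posInertia M ∧
      negInertia (M + A * Q * Aᴴ) + posInertia (bordered A M) ≤ (fromCols A M).rank := by
  induction hr : M.rank using Nat.strong_induction_on generalizing M with
  | _ r ih =>
    -- Either the bound already holds or a rank-lowering update exists. Updates change neither the
    -- inertia of the bordered matrix nor the rank of `[A, M]`, so the target survives the
    -- induction.
    by_cases h : ∀ (x : Fin m → ℂ) (z : Fin n → ℂ),
        M *ᵥ x = A *ᵥ z → 0 ≤ star x ⬝ᵥ (M *ᵥ x)
    · exact ⟨0, PosSemidef.zero, by simp, by simpa using inertia_le_rank_fromCols hM h⟩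
    · push Not at h
      obtain ⟨x, z, hxz, hneg⟩ := h
      obtain ⟨Q₁, hQ₁, hpos₁, hrank₁⟩ := exists_rank_lt hM hxz hneg
      have hM₁ : (M + A * Q₁ * Aᴴ).IsHermitian :=
        hM.add (hQ₁.mul_mul_conjTranspose_same A).isHermitian
      obtain ⟨Q₂, hQ₂, hpos₂, hneg₂⟩ := ih _ (hr ▸ hrank₁) hM₁ rfl
      have hsum : M + A * (Q₁ + Q₂) * Aᴴ = M + A * Q₁ * Aᴴ + A * Q₂ * Aᴴ := by
        rw [Matrix.mul_add, Matrix.add_mul, add_assoc]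
      rw [(bordered_shift hM hQ₁.isHermitian).1, Matrix.mul_assoc A Q₁, rank_fromCols_add,
        ← Matrix.mul_assoc] at hneg₂
      exact ⟨Q₁ + Q₂, hQ₁.add hQ₂, hsum ▸ hpos₂.trans hpos₁, hsum ▸ hneg₂⟩

/-- A solution of `A X A* ≽ B` whose residual is carried by the orthogonal complement of the
range of `A`. -/
theorem exists_minimal_solution (hfeas : (solutionSet A B).Nonempty) :
    ∃ X ∈ solutionSet A B, ∃ L : Matrix (Fin m) (Fin m) ℂ, Aᴴ * L = 0 ∧
      (A * X * Aᴴ - B) * L = A * X * Aᴴ - B := by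
  obtain ⟨X, hX, hN⟩ := hfeas
  obtain ⟨R, hR⟩ : ∃ R : Matrix (Fin m) (Fin m) ℂ, A * X * Aᴴ - B = Rᴴ * R := by
    open scoped MatrixOrder in
    exact CStarAlgebra.nonneg_iff_eq_star_mul_self.1 hN.nonneg
  obtain ⟨G, hG, hGA⟩ := exists_orthogonal_inner_inverse A
  set E := 1 - A * G with hE
  have hEH : Eᴴ = E := by rw [hE, conjTranspose_sub, conjTranspose_one, hG.eq]
  have hAE : Aᴴ * E = 0 := by
    have : E * A = 0 := by rw [hE, Matrix.sub_mul, Matrix.one_mul, hGA, sub_self]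
    rw [← hEH, ← conjTranspose_mul, this, conjTranspose_zero]
  obtain ⟨Z, hZ, hZR⟩ := exists_orthogonal_inner_inverse (R * E)
  -- `E` projects onto the orthogonal complement of the range of A, and `S` onto the range of `R *
  -- E`. Hence `R - S * R` vanishes on the range of `E`, so its Gram matrix has the form AYA* and
  -- can be subtracted by changing X.
  obtain ⟨S, hS⟩ : ∃ S, S = R * E * Z := ⟨_, rfl⟩
  rw [← hS] at hZ hZR
  have hidem : S * S = S := by
    rw [show S * S = S * (R * E) * Z by rw [Matrix.mul_assoc, ← hS], hZR, ← hS]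
  have hRA : (R - S * R) * (A * G) = R - S * R := by
    have : A * G = 1 - E := by rw [hE, sub_sub_cancel]
    rw [this, Matrix.mul_sub, Matrix.mul_one, Matrix.sub_mul, Matrix.mul_assoc S R E, hZR,
      sub_self, sub_zero]
  have hgram : (R - S * R)ᴴ * (R - S * R) = Rᴴ * R - Rᴴ * S * R := by
    have h1 : (R - S * R)ᴴ = Rᴴ - Rᴴ * S := by
      rw [conjTranspose_sub, conjTranspose_mul, hZ.eq]
    have h2 : Rᴴ * S * (S * R) = Rᴴ * S * R := by
      rw [Matrix.mul_assoc, ← Matrix.mul_assoc S, hidem, Matrix.mul_assoc]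
    rw [h1, Matrix.sub_mul, Matrix.mul_sub, Matrix.mul_sub, h2, sub_self, sub_zero,
      Matrix.mul_assoc]
  set X₀ := X - G * ((R - S * R)ᴴ * (R - S * R)) * Gᴴ with hX₀
  have hres : A * X₀ * Aᴴ - B = Rᴴ * S * R := by
    have h1 : A * (G * ((R - S * R)ᴴ * (R - S * R)) * Gᴴ) * Aᴴ
        = (R - S * R)ᴴ * (R - S * R) := by
      calc _ = (A * G) * ((R - S * R)ᴴ * (R - S * R)) * (A * G)ᴴ := by
            simp only [conjTranspose_mul, Matrix.mul_assoc]
        _ = ((R - S * R) * (A * G)ᴴ)ᴴ * ((R - S * R) * (A * G)ᴴ) := by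
            simp only [conjTranspose_mul, conjTranspose_conjTranspose, Matrix.mul_assoc]
        _ = _ := by rw [hG.eq, hRA]
    rw [hX₀, Matrix.mul_sub, Matrix.sub_mul, h1, hgram, sub_right_comm, hR, sub_sub_cancel]
  refine ⟨X₀, ⟨?_, ?_⟩, E * Z * R, ?_, ?_⟩
  · exact hX.sub (isHermitian_mul_mul_conjTranspose G (isHermitian_conjTranspose_mul_self _))
  · rw [hres]
    have : Rᴴ * S * R = (S * R)ᴴ * (S * R) := by
      rw [conjTranspose_mul, hZ.eq, Matrix.mul_assoc, Matrix.mul_assoc, ← Matrix.mul_assoc S S,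
        hidem]
    rw [this]
    exact posSemidef_conjTranspose_mul_self _
  · rw [← Matrix.mul_assoc, ← Matrix.mul_assoc, hAE, Matrix.zero_mul, Matrix.zero_mul]
  · rw [hres]
    calc Rᴴ * S * R * (E * Z * R) = Rᴴ * (S * S) * R := by
          rw [hS]; simp only [Matrix.mul_assoc]
      _ = _ := by rw [hidem]

/-- A minimal solution lies below every solution in the Löwner order. -/
theorem minimal_solution_le {X X₀ : Matrix (Fin n) (Fin n) ℂ} {L : Matrix (Fin m) (Fin m) ℂ}
    (hAL : Aᴴ * L = 0)
    (hL : (A * X₀ * Aᴴ - B) * L = A * X₀ * Aᴴ - B) (hX : X ∈ solutionSet A B) :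
    (A * X * Aᴴ - A * X₀ * Aᴴ).PosSemidef := by
  -- Compression by `1 - L` annihilates the residual of X₀ and fixes A, so exactly A(X - X₀)A*
  -- remains.
  have h := hX.2.conjTranspose_mul_mul_same (1 - L)
  have hsplit : A * X * Aᴴ - B = A * (X - X₀) * Aᴴ + (A * X₀ * Aᴴ - B) := by
    rw [Matrix.mul_sub, Matrix.sub_mul, sub_add_sub_cancel]
  have h1 : (A * X * Aᴴ - B) * (1 - L) = A * (X - X₀) * Aᴴ := by
    rw [hsplit, Matrix.add_mul, Matrix.mul_sub (A * X₀ * Aᴴ - B), Matrix.mul_one, hL, sub_self,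
      add_zero, Matrix.mul_sub, Matrix.mul_one, Matrix.mul_assoc (A * (X - X₀)), hAL,
      Matrix.mul_zero, sub_zero]
  have h2 : (1 - L)ᴴ * A = A := by
    have : Lᴴ * A = 0 := by
      have := congrArg conjTranspose hAL
      simpa [conjTranspose_mul] using this
    rw [conjTranspose_sub, conjTranspose_one, Matrix.sub_mul, Matrix.one_mul, this, sub_zero]
  rw [Matrix.mul_assoc, h1, ← Matrix.mul_assoc, ← Matrix.mul_assoc, h2, Matrix.mul_sub,
    Matrix.sub_mul] at h
  exact h

theorem matK1_isHermitian (hB : B.IsHermitian) (hC : C.IsHermitian) :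
    (matK1 A B C).IsHermitian := by
  refine hB.fromBlocks ?_ ((hB.sub hC).fromBlocks (by simp) isHermitian_zero)
  rw [conjTranspose_fromCols_eq_fromRows_conjTranspose, hB.eq]

theorem fromCols_add_fromCols {α β γ : Type*} (X X' : Matrix α β ℂ) (Y Y' : Matrix α γ ℂ) :
    fromCols X Y + fromCols X' Y' = fromCols (X + X') (Y + Y') := by
  ext i (j | j) <;> rfl

theorem fromRows_add_fromRows {α β γ : Type*} (X X' : Matrix β α ℂ) (Y Y' : Matrix γ α ℂ) :
    fromRows X Y + fromRows X' Y' = fromRows (X + X') (Y + Y') := by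
  ext (i | i) j <;> rfl

theorem inertia_matK1 (hB : B.IsHermitian) (hC : C.IsHermitian)
    {X : Matrix (Fin n) (Fin n) ℂ} {L : Matrix (Fin m) (Fin m) ℂ}
    (hX : X.IsHermitian) (hAL : Aᴴ * L = 0)
    (hL : (A * X * Aᴴ - B) * L = A * X * Aᴴ - B) :
    posInertia (matK1 A B C) = posInertia (bordered A B) + posInertia (A * X * Aᴴ - C) ∧
      negInertia (matK1 A B C) = negInertia (bordered A B) + negInertia (A * X * Aᴴ - C) := by
  have hHH : (A * X * Aᴴ).IsHermitian := isHermitian_mul_mul_conjTranspose A hX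
  have hLA : Lᴴ * A = 0 := by
    have := congrArg conjTranspose hAL
    simpa [conjTranspose_mul] using this
  set N := A * X * Aᴴ - B with hN
  have hNH : N.IsHermitian := hHH.sub hB
  have hLN : Lᴴ * N = N := by
    have := congrArg conjTranspose hL
    rwa [conjTranspose_mul, hNH.eq] at this
  have hshift := bordered_shift (A := A) hNH.neg hX
  have hHL : A * X * Aᴴ * L = 0 := by rw [Matrix.mul_assoc, hAL, Matrix.mul_zero]
  have hLH : Lᴴ * (A * X * Aᴴ) = 0 := by
    rw [← Matrix.mul_assoc, ← Matrix.mul_assoc, hLA, Matrix.zero_mul, Matrix.zero_mul]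
  have hBeq : -N + A * X * Aᴴ = B := by rw [hN]; abel
  rw [hBeq] at hshift
  rw [hshift.1, hshift.2, ← posInertia_fromBlocks_diagonal, ← negInertia_fromBlocks_diagonal]
  -- The last block column (-L, 1, -XA*) is sent by K₁ to (0, AXA* - C, 0), because BL = -N and A*L
  -- = 0; this decouples it. The other columns shift the corner B to -N, as in `bordered_shift`.
  set P : Matrix (Fin m ⊕ (Fin m ⊕ Fin n)) ((Fin m ⊕ Fin n) ⊕ Fin m) ℂ :=
    fromBlocks (fromCols 1 0) (-L) (fromBlocks 0 0 (-((2⁻¹ : ℂ) • (X * Aᴴ))) 1)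
      (fromRows 1 (-(X * Aᴴ))) with hP
  set P' : Matrix ((Fin m ⊕ Fin n) ⊕ Fin m) (Fin m ⊕ (Fin m ⊕ Fin n)) ℂ :=
    fromBlocks (fromRows 1 ((2⁻¹ : ℂ) • (X * Aᴴ))) (fromBlocks L 0 (X * Aᴴ) 1) 0
      (fromCols 1 0) with hP'
  have hinv : P * P' = 1 := by
    rw [hP, hP', fromBlocks_multiply, ← fromBlocks_one]
    simp only [fromCols_mul_fromRows, fromCols_mul_fromBlocks, fromBlocks_mul_fromRows,
      mul_fromCols, Matrix.mul_zero, Matrix.zero_mul, Matrix.one_mul, Matrix.mul_one, add_zero,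
      zero_add, fromBlocks_multiply]
    have h1 : -((2⁻¹ : ℂ) • (X * Aᴴ)) * L = 0 := by
      rw [Matrix.neg_mul, Matrix.smul_mul, Matrix.mul_assoc, hAL, Matrix.mul_zero, smul_zero,
        neg_zero]
    have h2 : fromBlocks 0 0 (X * Aᴴ) 1 + fromCols (fromRows 1 (-(X * Aᴴ))) 0
        = (1 : Matrix (Fin m ⊕ Fin n) (Fin m ⊕ Fin n) ℂ) := by
      rw [← fromCols_fromRows_eq_fromBlocks, fromCols_add_fromCols, fromRows_add_fromRows,
        zero_add, add_zero, add_neg_cancel, fromCols_fromRows_eq_fromBlocks, fromBlocks_one]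
    rw [h1, zero_add, h2, fromCols_add_fromCols, add_neg_cancel, neg_add_cancel, add_zero,
      fromCols_zero, fromRows_zero]
  have hBL : B * L = -N := by
    rw [← hBeq, Matrix.add_mul, hHL, Matrix.neg_mul, hL, add_zero]
  have hLB : Lᴴ * B = -N := by
    rw [← hBeq, Matrix.mul_add, hLH, Matrix.mul_neg, hLN, add_zero]
  have hstar : star (2⁻¹ : ℂ) = 2⁻¹ := by simp
  have hcong : Pᴴ * matK1 A B C * P
      = fromBlocks (bordered A (-N)) 0 0 (A * X * Aᴴ - C) := by
    rw [hP, matK1, fromBlocks_conjTranspose, fromBlocks_multiply, fromBlocks_multiply,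
      fromBlocks_conjTranspose, conjTranspose_fromCols_eq_fromRows_conjTranspose,
      conjTranspose_fromRows_eq_fromCols_conjTranspose]
    simp only [fromCols_mul_fromRows, fromCols_mul_fromBlocks, fromBlocks_mul_fromRows,
      mul_fromCols, fromRows_mul, Matrix.mul_zero, Matrix.zero_mul, Matrix.one_mul, Matrix.mul_one,
      add_zero, zero_add, fromBlocks_multiply, conjTranspose_zero, conjTranspose_one,
      fromBlocks_zero, fromRows_add_fromRows,
      fromCols_fromRows_eq_fromBlocks, conjTranspose_neg, conjTranspose_smul, conjTranspose_mul,
      conjTranspose_conjTranspose, hX.eq, bordered, Matrix.neg_mul, hLA, hLB, hstar,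
      Matrix.smul_mul, Matrix.mul_neg, Matrix.mul_smul, Matrix.add_mul, hBL, hAL, hHL, hL,
      neg_neg, neg_zero, smul_zero, ← Matrix.mul_assoc]
    have h1 : B + -(A * X * Aᴴ) = -N := by rw [← hBeq]; abel
    have h2 : N + -N = 0 := add_neg_cancel N
    have h3 : fromCols (fromRows (B + -((2⁻¹ : ℂ) • (A * X * Aᴴ))) Aᴴ) 0
        + fromBlocks (-((2⁻¹ : ℂ) • (A * X * Aᴴ))) A 0 0 = fromBlocks (-N) A Aᴴ 0 := by
      rw [← fromCols_fromRows_eq_fromBlocks, fromCols_add_fromCols, fromRows_add_fromRows,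
        ← fromCols_fromRows_eq_fromBlocks, ← h1, zero_add, add_zero]
      congr 2
      module
    have h4 : N + (B - C) = A * X * Aᴴ - C := by rw [← hBeq]; abel
    have h5 : fromCols N 0 + (fromCols B 0 + -fromCols (A * X * Aᴴ) 0)
        = (0 : Matrix (Fin m) (Fin m ⊕ Fin n) ℂ) := by
      rw [← hBeq]
      ext i (j | j) <;> simp
    simp only [h1, h2, h3, h4, h5, neg_add_cancel, neg_zero, zero_add]
  exact ⟨posInertia_congr (matK1_isHermitian hB hC) P P' hinv hcong,
    negInertia_congr (matK1_isHermitian hB hC) P P' hinv hcong⟩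

end Extremal

end LownerIneq

/-! ### The extremal formulas and their consequences. -/

theorem mainTheorem12 (m n : ℕ) (A : Matrix (Fin m) (Fin n) ℂ)
    (B C : Matrix (Fin m) (Fin m) ℂ) (hB : B.IsHermitian) (hC : C.IsHermitian)
    (hfeas : (LownerIneq.solutionSet A B).Nonempty) :
    -- the six extremal formulas over the solution set of `A X A* ≽ B`
    (IsGreatest ((fun X => ((A * X * A.conjTranspose - C).rank : ℤ)) ''
          LownerIneq.solutionSet A B)
        ((Matrix.fromCols A C).rank : ℤ) ∧
      IsLeast ((fun X => ((A * X * A.conjTranspose - C).rank : ℤ)) ''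
          LownerIneq.solutionSet A B)
        ((LownerIneq.posInertia (LownerIneq.matK1 A B C) : ℤ)
          - (LownerIneq.posInertia (LownerIneq.bordered A B) : ℤ)
          - (LownerIneq.negInertia (LownerIneq.bordered A C) : ℤ)
          + ((Matrix.fromCols A C).rank : ℤ)) ∧
      IsGreatest ((fun X => (LownerIneq.posInertia (A * X * A.conjTranspose - C) : ℤ)) ''
          LownerIneq.solutionSet A B)
        (LownerIneq.negInertia (LownerIneq.bordered A C) : ℤ) ∧
      IsGreatest ((fun X => (LownerIneq.negInertia (A * X * A.conjTranspose - C) : ℤ)) ''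
          LownerIneq.solutionSet A B)
        ((LownerIneq.negInertia (LownerIneq.matK1 A B C) : ℤ)
          - (LownerIneq.negInertia (LownerIneq.bordered A B) : ℤ)) ∧
      IsLeast ((fun X => (LownerIneq.posInertia (A * X * A.conjTranspose - C) : ℤ)) ''
          LownerIneq.solutionSet A B)
        ((LownerIneq.posInertia (LownerIneq.matK1 A B C) : ℤ)
          - (LownerIneq.posInertia (LownerIneq.bordered A B) : ℤ)) ∧
      IsLeast ((fun X => (LownerIneq.negInertia (A * X * A.conjTranspose - C) : ℤ)) ''
          LownerIneq.solutionSet A B)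
        (((Matrix.fromCols A C).rank : ℤ)
          - (LownerIneq.negInertia (LownerIneq.bordered A C) : ℤ))) ∧
    -- (a) `A X A* ≽ B` and `A X A* ≻ C`
    ((∃ X : Matrix (Fin n) (Fin n) ℂ, X.IsHermitian ∧
        (A * X * A.conjTranspose - B).PosSemidef ∧ (A * X * A.conjTranspose - C).PosDef) ↔
      LownerIneq.negInertia (LownerIneq.bordered A C) = m) ∧
    -- (b) `C ≻ A X A* ≽ B`
    ((∃ X : Matrix (Fin n) (Fin n) ℂ, X.IsHermitian ∧
        (C - A * X * A.conjTranspose).PosDef ∧ (A * X * A.conjTranspose - B).PosSemidef) ↔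
      (C - B).PosDef ∧
        LownerIneq.negInertia (LownerIneq.matK1 A B C)
          = LownerIneq.negInertia (LownerIneq.bordered A B) + m) ∧
    -- (c) `C ≽ A X A* ≽ B`
    ((∃ X : Matrix (Fin n) (Fin n) ℂ, X.IsHermitian ∧
        (C - A * X * A.conjTranspose).PosSemidef ∧ (A * X * A.conjTranspose - B).PosSemidef) ↔
      (C - B).PosSemidef ∧
        LownerIneq.posInertia (LownerIneq.matK1 A B C)
          = LownerIneq.posInertia (LownerIneq.bordered A B)) ∧
    -- (d) `A X A* ≽ B` and `A X A* ≽ C`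
    ((∃ X : Matrix (Fin n) (Fin n) ℂ, X.IsHermitian ∧
        (A * X * A.conjTranspose - B).PosSemidef ∧ (A * X * A.conjTranspose - C).PosSemidef) ↔
      LownerIneq.negInertia (LownerIneq.bordered A C) = (Matrix.fromCols A C).rank) := by

  obtain ⟨X₀, hX₀, L, hAL, hL⟩ := LownerIneq.exists_minimal_solution hfeas
  have hK1 := LownerIneq.inertia_matK1 hB hC hX₀.1 hAL hL
  have hAX (X : Matrix (Fin n) (Fin n) ℂ) (hX : X.IsHermitian) :
      (A * X * A.conjTranspose).IsHermitian := Matrix.isHermitian_mul_mul_conjTranspose A hX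
  have hFH (X : Matrix (Fin n) (Fin n) ℂ) (hX : X.IsHermitian) :
      (A * X * A.conjTranspose - C).IsHermitian := (hAX X hX).sub hC
  have hdecomp (X : Matrix (Fin n) (Fin n) ℂ) :
      A * X * A.conjTranspose - C = -C + A * X * A.conjTranspose := by abel
  have hK2 (X : Matrix (Fin n) (Fin n) ℂ) (hX : X.IsHermitian) :
      LownerIneq.posInertia (LownerIneq.bordered A (A * X * A.conjTranspose - C))
        = LownerIneq.negInertia (LownerIneq.bordered A C) := by
    rw [hdecomp, (LownerIneq.bordered_shift hC.neg hX).1, LownerIneq.negInertia_bordered hC]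
  have hrk (X : Matrix (Fin n) (Fin n) ℂ) :
      (Matrix.fromCols A (A * X * A.conjTranspose - C)).rank = (Matrix.fromCols A C).rank := by
    rw [hdecomp, Matrix.mul_assoc, LownerIneq.rank_fromCols_add, LownerIneq.rank_fromCols_neg]
  have hsum (X : Matrix (Fin n) (Fin n) ℂ) (hX : X.IsHermitian) :=
    LownerIneq.posInertia_add_negInertia (hFH X hX)
  have hposle (X : Matrix (Fin n) (Fin n) ℂ) (hX : X.IsHermitian) :=
    hK2 X hX ▸ LownerIneq.posInertia_le_bordered (A := A) (hFH X hX)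
  have hrkle (X : Matrix (Fin n) (Fin n) ℂ) :=
    hrk X ▸ LownerIneq.rank_le_rank_fromCols (A := A) (M := A * X * A.conjTranspose - C)
  have hnegge (X : Matrix (Fin n) (Fin n) ℂ) (hX : X.IsHermitian) :
      (Matrix.fromCols A C).rank ≤ LownerIneq.negInertia (A * X * A.conjTranspose - C)
        + LownerIneq.negInertia (LownerIneq.bordered A C) := by
    have h := LownerIneq.rank_fromCols_le_inertia (A := A) (hFH X hX)
    rwa [hrk, hK2 X hX] at h
  have hposge (X) (hX : X ∈ LownerIneq.solutionSet A B) :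
      LownerIneq.posInertia (A * X₀ * A.conjTranspose - C)
        ≤ LownerIneq.posInertia (A * X * A.conjTranspose - C) :=
    LownerIneq.posInertia_mono (hFH _ hX₀.1) (by
      rw [sub_sub_sub_cancel_right]
      exact LownerIneq.minimal_solution_le hAL hL hX)
  have hnegle (X) (hX : X ∈ LownerIneq.solutionSet A B) :
      LownerIneq.negInertia (A * X * A.conjTranspose - C)
        ≤ LownerIneq.negInertia (A * X₀ * A.conjTranspose - C) := by
    rw [LownerIneq.negInertia_eq_posInertia_neg (hFH _ hX.1),
      LownerIneq.negInertia_eq_posInertia_neg (hFH _ hX₀.1)]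
    refine LownerIneq.posInertia_mono (hFH _ hX.1).neg ?_
    rw [neg_sub_neg, sub_sub_sub_cancel_right]
    exact LownerIneq.minimal_solution_le hAL hL hX
  have hmem (Q : Matrix (Fin n) (Fin n) ℂ) (hQ : Q.PosSemidef) :
      X₀ + Q ∈ LownerIneq.solutionSet A B := by
    refine ⟨hX₀.1.add hQ.isHermitian, ?_⟩
    rw [Matrix.mul_add, Matrix.add_mul, add_sub_right_comm]
    exact hX₀.2.add (hQ.mul_mul_conjTranspose_same A)
  have hupd (Q : Matrix (Fin n) (Fin n) ℂ) :
      A * X₀ * A.conjTranspose - C + A * Q * A.conjTranspose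
        = A * (X₀ + Q) * A.conjTranspose - C := by
    rw [Matrix.mul_add, Matrix.add_mul, add_sub_right_comm]
  -- Maximal i₊ at `Xa` also gives the maximal rank and the minimal i₋: i₊ + i₋ is at most r[A, C],
  -- while i₋ ≥ r[A, C] - i₋(K₂).
  obtain ⟨Xa, hXa, hpa⟩ : ∃ X ∈ LownerIneq.solutionSet A B,
      LownerIneq.negInertia (LownerIneq.bordered A C)
        ≤ LownerIneq.posInertia (A * X * A.conjTranspose - C) := by
    obtain ⟨Q, hQ, h⟩ := LownerIneq.exists_posInertia_bordered_le (A := A) (hFH X₀ hX₀.1)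
    rw [hupd, hK2 X₀ hX₀.1] at h
    exact ⟨X₀ + Q, hmem Q hQ, h⟩
  -- Starting the updates at `X₀` keeps i₊ at its minimum while i₋ falls to its own, so the minimal
  -- rank is the sum of the two minima.
  obtain ⟨Xb, hXb, hpb, hnb⟩ : ∃ X ∈ LownerIneq.solutionSet A B,
      LownerIneq.posInertia (A * X * A.conjTranspose - C)
        ≤ LownerIneq.posInertia (A * X₀ * A.conjTranspose - C) ∧
      LownerIneq.negInertia (A * X * A.conjTranspose - C)
        + LownerIneq.negInertia (LownerIneq.bordered A C) ≤ (Matrix.fromCols A C).rank := by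
    obtain ⟨Q, hQ, h, h'⟩ := LownerIneq.exists_minimal_inertia (A := A) (hFH X₀ hX₀.1)
    rw [hupd] at h h'
    rw [hK2 X₀ hX₀.1, hrk] at h'
    exact ⟨X₀ + Q, hmem Q hQ, h, h'⟩
  obtain ⟨hK1p, hK1n⟩ := hK1
  have hsa := hsum Xa hXa.1
  have hra := hrkle Xa
  have hna := hnegge Xa hXa.1
  have hca := hposle Xa hXa.1
  have hsb := hsum Xb hXb.1
  have hnb' := hnegge Xb hXb.1
  have hpb' := hposge Xb hXb
  have hnegswap (X : Matrix (Fin n) (Fin n) ℂ) :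
      -(A * X * A.conjTranspose - C) = C - A * X * A.conjTranspose := neg_sub _ _
  have hnegF (X : Matrix (Fin n) (Fin n) ℂ) (hX : X.IsHermitian) :=
    hnegswap X ▸ LownerIneq.negInertia_eq_posInertia_neg (hFH X hX)
  have hposF (X : Matrix (Fin n) (Fin n) ℂ) (hX : X.IsHermitian) :=
    hnegswap X ▸ LownerIneq.posInertia_eq_negInertia_neg (hFH X hX)
  have hCF (X : Matrix (Fin n) (Fin n) ℂ) (hX : X.IsHermitian) := hC.sub (hAX X hX)
  have hadd (X : Matrix (Fin n) (Fin n) ℂ) :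
      C - A * X * A.conjTranspose + (A * X * A.conjTranspose - B) = C - B :=
    sub_add_sub_cancel _ _ _
  have hcard {H : Matrix (Fin m) (Fin m) ℂ} (hH : H.IsHermitian) :
      H.PosDef ↔ LownerIneq.posInertia H = m := by
    rw [LownerIneq.posDef_iff_posInertia hH, Fintype.card_fin]
  have hlem {H : Matrix (Fin m) (Fin m) ℂ} (hH : H.IsHermitian) :
      LownerIneq.posInertia H ≤ m := by
    simpa using LownerIneq.posInertia_le_card hH
  refine ⟨⟨⟨⟨Xa, hXa, ?_⟩, ?_⟩, ⟨⟨Xb, hXb, ?_⟩, ?_⟩, ⟨⟨Xa, hXa, ?_⟩, ?_⟩, ⟨⟨X₀, hX₀, ?_⟩, ?_⟩,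
    ⟨⟨X₀, hX₀, ?_⟩, ?_⟩, ⟨⟨Xa, hXa, ?_⟩, ?_⟩⟩, ⟨?_, ?_⟩, ⟨?_, ?_⟩, ⟨?_, ?_⟩, ⟨?_, ?_⟩⟩
  · dsimp only; omega
  · rintro _ ⟨X, hX, rfl⟩
    dsimp only; exact_mod_cast hrkle X
  · dsimp only; omega
  · rintro _ ⟨X, hX, rfl⟩
    have h1 := hsum X hX.1
    have h2 := hnegge X hX.1
    have h3 := hposge X hX
    dsimp only; omega
  · dsimp only; omega
  · rintro _ ⟨X, hX, rfl⟩
    dsimp only; exact_mod_cast hposle X hX.1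
  · dsimp only; omega
  · rintro _ ⟨X, hX, rfl⟩
    have h1 := hnegle X hX
    dsimp only; omega
  · dsimp only; omega
  · rintro _ ⟨X, hX, rfl⟩
    have h1 := hposge X hX
    dsimp only; omega
  · dsimp only; omega
  · rintro _ ⟨X, hX, rfl⟩
    have h1 := hnegge X hX.1
    dsimp only; omega
  · rintro ⟨X, hX, hXB, hXC⟩
    have h1 := (hcard (hFH X hX)).1 hXC
    have h2 := hposle X hX
    have h3 := hlem (hFH Xa hXa.1)
    omega
  · intro h
    exact ⟨Xa, hXa.1, hXa.2, (hcard (hFH Xa hXa.1)).2 (by omega)⟩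
  · rintro ⟨X, hX, hXC, hXB⟩
    refine ⟨hadd X ▸ hXC.add_posSemidef hXB, ?_⟩
    have h1 := (hcard (hCF X hX)).1 hXC
    have h2 := hnegF X hX
    have h3 := hnegF X₀ hX₀.1
    have h4 := hlem (hCF X₀ hX₀.1)
    have h5 := hnegle X ⟨hX, hXB⟩
    omega
  · rintro ⟨-, h⟩
    have h3 := hnegF X₀ hX₀.1
    exact ⟨X₀, hX₀.1, (hcard (hCF X₀ hX₀.1)).2 (by omega), hX₀.2⟩
  · rintro ⟨X, hX, hXC, hXB⟩
    refine ⟨hadd X ▸ hXC.add hXB, ?_⟩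
    have h1 := (LownerIneq.posSemidef_iff_negInertia (hCF X hX)).1 hXC
    have h2 := hposF X hX
    have h5 := hposge X ⟨hX, hXB⟩
    omega
  · rintro ⟨-, h⟩
    have h3 := hposF X₀ hX₀.1
    exact ⟨X₀, hX₀.1, (LownerIneq.posSemidef_iff_negInertia (hCF X₀ hX₀.1)).2 (by omega), hX₀.2⟩
  · rintro ⟨X, hX, hXB, hXC⟩
    have h1 := (LownerIneq.posSemidef_iff_negInertia (hFH X hX)).1 hXC
    have h2 := hnegge X hX
    omega
  · intro h
    exact ⟨Xa, hXa.1, hXa.2,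
      (LownerIneq.posSemidef_iff_negInertia (hFH Xa hXa.1)).2 (by omega)⟩
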